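/- **Proposition 2.1.** For $k\in\mathbb Z_{\ge 0}$ put $(a;q)_k=\prod_{i=0}^{k-1}(1-aq^i)$, and for $|q|<1$ put $(a;q)_\infty=\prod_{i=0}^{\infty}(1-aq^i)$. Let $\nu\in\mathbb{Z}_{\ge0}$. For $q\in\mathbb{C}$ with $|q|<1$, the $q$-Bessel function $J_\nu(x)=J_\nu(x;q)$ is the function of $x\in\mathbb C$ given for $|(1-q)x|<1$ by the convergent series $$J_\nu(x)=(1-q)^{\nu}x^\nu\sum_{j=0}^{\infty}\frac{(-1)^j(1-q)^{2j}}{(q^2;q^2)_{j}(q^2;q^2)_{\nu+j}}x^{2j}$$ and elsewhere by its meromorphic continuation to $\mathbb{C}$. This continuation exists and is unique, and the following hold. (i) For all $q\in\mathbb C$ with $|q|<1$ and all $x\in\mathbb{C}$, the product $(-(1-q)^2x^2;q^2)_\infty$ and the series below converge, and whenever $1+(1-q)^2x^2q^{2i}\ne0$ for all $i\ge0$, this product is nonzero and $$J_\nu(x)=\frac{(1-q)^\nu x^\nu}{(-(1-q)^2x^2;q^2)_\infty}\sum_{k=0}^{\infty}\frac{(-1)^kq^{2k(k+\nu)}(1-q)^{2k}}{(q^2;q^2)_k(q^2;q^2)_{k+\nu}}x^{2k}.$$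 (ii) For every $n\in\mathbb{Z}$, as $q\to0$ ($q\in\mathbb C$, $q\neq0$), $$J_\nu(q^n)=\begin{cases} q^{n\nu}\left(1+O(q)\right)&(n\ge 1)\\ q^{n(n+\nu-1)}\left(\frac{1}{2}+O(q)\right)&(0\ge n\ge -\nu)\\ (-1)^{\frac{n+\nu}{2}}q^{\frac{n(n-2)-\nu^2}{2}}\left(\frac{1}{2}+O(q)\right)&(n\le -\nu-1,\ n+\nu\text{ even})\\ (-1)^{\frac{n+\nu+1}{2}}q^{\frac{n(n-2)-\nu^2+3}{2}}\left(1+O(q)\right)&(n\le -\nu-1,\ n+\nu\text{ odd}), \end{cases}$$ where the implied constants may depend on $\nu$ and $n$. -/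

import Mathlib

open Filter Topology Asymptotics

/-- The finite `q`-shifted factorial `(a; q)_k = (1 - a)(1 - a q) ⋯ (1 - a q^(k-1))`. -/
noncomputable def qPoch (a q : ℂ) (k : ℕ) : ℂ :=
  ∏ i ∈ Finset.range k, (1 - a * q ^ i)

/-- The infinite `q`-shifted factorial `(a; q)_∞ = ∏_{i ≥ 0} (1 - a q^i)`. -/
noncomputable def qPochInf (a q : ℂ) : ℂ :=
  ∏' i : ℕ, (1 - a * q ^ i)

/-- The `j`-th term of the power series of the `q`-Bessel function of order `ν`
(prefactor included). -/
noncomputable def qBesselTerm (q : ℂ) (ν : ℕ) (x : ℂ) (j : ℕ) : ℂ :=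
  (1 - q) ^ ν * x ^ ν *
    ((-1) ^ j * (1 - q) ^ (2 * j) / (qPoch (q ^ 2) (q ^ 2) j * qPoch (q ^ 2) (q ^ 2) (ν + j))
      * x ^ (2 * j))

/-- `J` is the `q`-Bessel function of order `ν`: it is the sum of the defining power series on the
disc of convergence `|(1 - q) x| < 1`, continued meromorphically to the whole plane.
The normal form only fixes the values at single points: `J` takes its limit value wherever it
has one, and the value `0` at poles. -/
structure IsQBessel (q : ℂ) (ν : ℕ) (J : ℂ → ℂ) : Prop where
  meromorphic : MeromorphicNFOn J Set.univ
  hasSum : ∀ x : ℂ, ‖(1 - q) * x‖ < 1 → HasSum (qBesselTerm q ν x) (J x)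

open Classical in
/-- The `q`-Bessel function `J_ν(x)` with base `q`: the function characterised by `IsQBessel`. (That
there is exactly one such function for `|q| < 1` is a part of the theorem; the value `0` stands for
the case that there is none.) -/
noncomputable def qBessel (q : ℂ) (ν : ℕ) : ℂ → ℂ :=
  if h : ∃ J : ℂ → ℂ, IsQBessel q ν J then h.choose else 0

/-- `F(q) = s q^e (c + O(q))` as `q → 0`, `q ≠ 0`. -/
def HasLeadingTerm (F : ℂ → ℂ) (s : ℂ) (e : ℤ) (c : ℂ) : Prop :=
  ∃ E : ℂ → ℂ, E =O[𝓝[≠] (0 : ℂ)] (fun q : ℂ => q) ∧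
    ∀ᶠ q in 𝓝[≠] (0 : ℂ), F q = s * q ^ e * (c + E q)

/-!
Put `p = q ^ 2` and `z = (1 - q) ^ 2 x ^ 2`, so that up to the prefactor `((1 - q) x) ^ ν` the
`q`-Bessel function is `F z = ∑ (-1) ^ j z ^ j / ((p; p)_j (p; p)_{ν + j})`.

The recurrence of the coefficients says that
`(1 + z) F(z) = (1 + p ^ ν) F(p z) - p ^ ν F(p ^ 2 z)`. Together with
`(-z; p)_∞ = (1 + z) (-p z; p)_∞` this gives a `p`-difference equation for the product
`(-z; p)_∞ F(z)` whose coefficients are determined by a two-term recurrence, and the recurrence is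
solved by the transformed series. This is carried out on formal power series
(`mk_eulerCoeff_mul_mk_besselCoeff`), with Euler's series in place of `(-z; p)_∞`; the two agree by
iterating the functional equation (`qPochInf_neg_eq_eulerSeries`). The transformed series and the
product are entire, so their quotient is the meromorphic continuation; the identity principle for
meromorphic functions in normal form (`MeromorphicNFOn.eq_of_eventuallyEq`) gives uniqueness.

For the behaviour as `q → 0` at `x = q ^ n`: if `n ≥ 1` the defining series converges and is
dominated by its first term. If `n = -m ≤ 0`, the product in the denominator equals
`q ^ (-m (m + 1)) D(q)` with `D` analytic at `0` and `D 0 = 2` (`eulerSeries_zpow_asymptotic`), and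
the terms of the numerator carry the powers `q ^ (2 k (k + ν + n))`. The exponent is a convex
quadratic function of `k`. For `n ≥ -ν` its minimum is at `k = 0`, and for `n + ν = -2 r` at
`k = r`; in both cases one term dominates (`hasLeadingTerm_qBessel_of_dominant`). For
`n + ν = -(2 r + 1)` the minimum is attained at `r` and `r + 1`, the two terms cancel to leading
order, and their sum contributes at the next power of `q` (`hasLeadingTerm_qBessel_of_odd`). After
a power of `q` is divided out, every series in sight is analytic at `q = 0`, by domination on a
small disc, and this yields the error terms `O(q)`.
-/

/-! ### Finite `q`-shifted factorials -/

lemma one_sub_pow_succ_ne_zero {p : ℂ} (hp : ‖p‖ < 1) (k : ℕ) : 1 - p ^ (k + 1) ≠ 0 := by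
  intro h
  have h1 : ‖p ^ (k + 1)‖ < 1 := by
    rw [norm_pow]; exact pow_lt_one₀ (norm_nonneg _) hp k.succ_ne_zero
  rw [← sub_eq_zero.mp h, norm_one] at h1
  exact lt_irrefl _ h1

lemma qPoch_self_succ (p : ℂ) (k : ℕ) :
    qPoch p p (k + 1) = qPoch p p k * (1 - p ^ (k + 1)) := by
  rw [qPoch, Finset.prod_range_succ, ← pow_succ', qPoch]

lemma qPoch_self_ne_zero {p : ℂ} (hp : ‖p‖ < 1) (k : ℕ) : qPoch p p k ≠ 0 := by
  refine Finset.prod_ne_zero_iff.mpr fun i _ => ?_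
  rw [← pow_succ']
  exact one_sub_pow_succ_ne_zero hp i

/-! ### The coefficient sequences and their recurrences -/

/-- The coefficient of `z ^ m` in Euler's expansion of the product `(-z; p)_∞`. -/
noncomputable def eulerCoeff (p : ℂ) (m : ℕ) : ℂ := p ^ m.choose 2 / qPoch p p m

/-- The coefficient of `z ^ j` in the defining series of the `q`-Bessel function, where
`p = q ^ 2` and `z = ((1 - q) x) ^ 2`. -/
noncomputable def besselCoeff (p : ℂ) (ν j : ℕ) : ℂ :=
  (-1) ^ j / (qPoch p p j * qPoch p p (ν + j))

/-- The coefficient of `z ^ k` in the product of the `q`-Bessel series with `(-z; p)_∞`. -/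
noncomputable def entireCoeff (p : ℂ) (ν k : ℕ) : ℂ :=
  (-1) ^ k * p ^ (k * (k + ν)) / (qPoch p p k * qPoch p p (k + ν))

lemma eulerCoeff_zero (p : ℂ) : eulerCoeff p 0 = 1 := by simp [eulerCoeff, qPoch]

lemma eulerCoeff_succ {p : ℂ} (hp : ‖p‖ < 1) (m : ℕ) :
    eulerCoeff p (m + 1) = p ^ m / (1 - p ^ (m + 1)) * eulerCoeff p m := by
  have h1 := qPoch_self_ne_zero hp m
  have h2 := one_sub_pow_succ_ne_zero hp m
  rw [eulerCoeff, eulerCoeff, qPoch_self_succ, Nat.choose_succ_succ' m 1, Nat.choose_one_right,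
    pow_add]
  field_simp

lemma besselCoeff_succ {p : ℂ} (hp : ‖p‖ < 1) (ν j : ℕ) :
    besselCoeff p ν (j + 1) =
      -1 / ((1 - p ^ (j + 1)) * (1 - p ^ (ν + j + 1))) * besselCoeff p ν j := by
  have h1 := qPoch_self_ne_zero hp j
  have h2 := one_sub_pow_succ_ne_zero hp j
  have h3 := qPoch_self_ne_zero hp (ν + j)
  have h4 := one_sub_pow_succ_ne_zero hp (ν + j)
  rw [besselCoeff, besselCoeff, qPoch_self_succ, ← add_assoc, qPoch_self_succ, pow_succ]
  field_simp

lemma entireCoeff_succ {p : ℂ} (hp : ‖p‖ < 1) (ν k : ℕ) :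
    entireCoeff p ν (k + 1) =
      -p ^ (2 * k + 1 + ν) / ((1 - p ^ (k + 1)) * (1 - p ^ (ν + k + 1))) * entireCoeff p ν k := by
  have h1 := qPoch_self_ne_zero hp k
  have h2 := one_sub_pow_succ_ne_zero hp k
  have h3 := qPoch_self_ne_zero hp (ν + k)
  have h4 := one_sub_pow_succ_ne_zero hp (ν + k)
  have h5 : (k + 1) * (ν + k + 1) = k * (ν + k) + (2 * k + 1 + ν) := by ring
  rw [entireCoeff, entireCoeff, qPoch_self_succ, show k + 1 + ν = ν + k + 1 by ring,
    qPoch_self_succ, add_comm k ν, pow_succ, h5, pow_add]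
  field_simp

/-! ### The product of the Bessel series with Euler's series -/

open PowerSeries in
lemma constantCoeff_rescale_eq (p : ℂ) (f : PowerSeries ℂ) :
    constantCoeff (rescale p f) = constantCoeff f := by
  rw [← coeff_zero_eq_constantCoeff_apply, coeff_rescale]
  simp

open PowerSeries in
/-- The formal counterpart of `(-z; p)_∞ = (1 + z) (-p z; p)_∞`. -/
lemma mk_eulerCoeff_eq {p : ℂ} (hp : ‖p‖ < 1) :
    mk (eulerCoeff p) = (1 + X) * rescale p (mk (eulerCoeff p)) := by
  ext n
  rcases n with _ | n
  · simp [constantCoeff_rescale_eq]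
  · have h := one_sub_pow_succ_ne_zero hp n
    rw [add_mul, one_mul, map_add, coeff_succ_X_mul]
    simp only [coeff_rescale, coeff_mk, eulerCoeff_succ hp]
    field_simp
    ring

open PowerSeries in
/-- The second order `p`-difference equation of the Bessel series. -/
lemma mk_besselCoeff_eq {p : ℂ} (hp : ‖p‖ < 1) (ν : ℕ) :
    (1 + X) * mk (besselCoeff p ν) = (1 + C (p ^ ν)) * rescale p (mk (besselCoeff p ν)) -
      C (p ^ ν) * rescale p (rescale p (mk (besselCoeff p ν))) := by
  ext n
  rcases n with _ | n
  · simp [constantCoeff_rescale_eq, add_mul]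
  · have h := one_sub_pow_succ_ne_zero hp n
    have h' := one_sub_pow_succ_ne_zero hp (ν + n)
    rw [add_mul, one_mul, add_mul, one_mul, map_add, map_sub, map_add, coeff_succ_X_mul]
    simp only [coeff_rescale, coeff_C_mul, coeff_mk, besselCoeff_succ hp]
    field_simp
    ring

open PowerSeries in
/-- Multiplying the Bessel series by Euler's series turns its difference equation into one
which again determines the coefficients recursively. -/
lemma mk_eulerCoeff_mul_mk_besselCoeff {p : ℂ} (hp : ‖p‖ < 1) (ν : ℕ) :
    mk (eulerCoeff p) * mk (besselCoeff p ν) = mk (entireCoeff p ν) := by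
  set E := mk (eulerCoeff p) with hE
  set F := mk (besselCoeff p ν) with hF
  have h1 : E = (1 + X) * rescale p E := mk_eulerCoeff_eq hp
  have h2 : rescale p E = (1 + C p * X) * rescale p (rescale p E) := by
    conv_lhs => rw [h1]
    rw [map_mul, map_add, map_one, rescale_X]
  have h3 := mk_besselCoeff_eq hp ν
  rw [← hF] at h3
  have h4 : E * F = (1 + C (p ^ ν)) * rescale p (E * F) -
      C (p ^ ν) * (rescale p (rescale p (E * F)) +
        C p * (X * rescale p (rescale p (E * F)))) := by
    simp only [map_mul]
    linear_combination F * h1 + rescale p E * h3 +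
      (-C (p ^ ν) * rescale p (rescale p F)) * h2
  ext n
  induction n with
  | zero =>
    simp [hE, hF, eulerCoeff, besselCoeff, entireCoeff, qPoch]
  | succ n ih =>
    have h := one_sub_pow_succ_ne_zero hp n
    have h' := one_sub_pow_succ_ne_zero hp (ν + n)
    have h5 := congrArg (coeff (n + 1)) h4
    rw [add_mul, one_mul, map_sub, map_add, coeff_C_mul, coeff_C_mul, map_add, coeff_C_mul,
      coeff_succ_X_mul] at h5
    simp only [coeff_rescale, ih, coeff_mk] at h5
    rw [coeff_mk, entireCoeff_succ hp]
    field_simp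
    linear_combination h5

/-! ### Convergence -/

/-- The ratio test in a form that allows vanishing terms (`c n = 0` occurs for `p = 0`). -/
lemma summable_norm_mul_pow_of_ratio {a c : ℕ → ℂ} (h : ∀ n, a (n + 1) = c n * a n) {L z : ℂ}
    (hc : Tendsto c atTop (𝓝 L)) (hz : ‖L * z‖ < 1) : Summable fun n => ‖a n * z ^ n‖ := by
  obtain ⟨r, hr, hr1⟩ := exists_between hz
  refine summable_of_ratio_norm_eventually_le hr1 ?_
  filter_upwards [((hc.mul_const z).norm).eventually_lt_const hr] with n hn
  rw [norm_norm, norm_norm, h, pow_succ, show c n * a n * (z ^ n * z) = c n * z * (a n * z ^ n) by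
    ring, norm_mul]
  gcongr

lemma differentiable_tsum_mul_pow {a : ℕ → ℂ} (h : ∀ z : ℂ, Summable fun n => ‖a n * z ^ n‖) :
    Differentiable ℂ fun z => ∑' n, a n * z ^ n := by
  intro z
  refine (Complex.differentiableOn_tsum_of_summable_norm (h ((‖z‖ + 1 : ℝ) : ℂ)) (fun n => ?_)
    Metric.isOpen_ball (U := Metric.ball 0 (‖z‖ + 1)) ?_).differentiableAt
    (Metric.isOpen_ball.mem_nhds (by simp))
  · fun_prop
  · intro n w hw
    rw [norm_mul, norm_mul, norm_pow, norm_pow, Complex.norm_real,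
      Real.norm_of_nonneg (by positivity)]
    gcongr
    exact (mem_ball_zero_iff.mp hw).le

lemma tendsto_one_sub_pow {p : ℂ} (hp : ‖p‖ < 1) (m : ℕ) :
    Tendsto (fun n => 1 - p ^ (m + n + 1)) atTop (𝓝 1) := by
  have h := (tendsto_pow_atTop_nhds_zero_of_norm_lt_one hp).comp
    (tendsto_add_atTop_nat (m + 1))
  simpa [Function.comp_def, add_assoc, add_comm, add_left_comm] using h.const_sub 1

lemma summable_norm_eulerCoeff {p : ℂ} (hp : ‖p‖ < 1) (z : ℂ) :
    Summable fun n => ‖eulerCoeff p n * z ^ n‖ := by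
  refine summable_norm_mul_pow_of_ratio (L := 0) (eulerCoeff_succ hp) ?_ (by simp)
  simpa [Pi.div_def] using (tendsto_pow_atTop_nhds_zero_of_norm_lt_one hp).div
    (tendsto_one_sub_pow hp 0) one_ne_zero

lemma summable_norm_besselCoeff {p : ℂ} (hp : ‖p‖ < 1) (ν : ℕ) {z : ℂ} (hz : ‖z‖ < 1) :
    Summable fun n => ‖besselCoeff p ν n * z ^ n‖ := by
  refine summable_norm_mul_pow_of_ratio (L := -1) (besselCoeff_succ hp ν) ?_ (by simpa)
  simpa [Pi.div_def] using (tendsto_const_nhds (x := (-1 : ℂ))).div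
    ((tendsto_one_sub_pow hp 0).mul (tendsto_one_sub_pow hp ν)) (by simp)

lemma summable_norm_entireCoeff {p : ℂ} (hp : ‖p‖ < 1) (ν : ℕ) (z : ℂ) :
    Summable fun n => ‖entireCoeff p ν n * z ^ n‖ := by
  refine summable_norm_mul_pow_of_ratio (L := 0) (entireCoeff_succ hp ν) ?_ (by simp)
  have h : Tendsto (fun k : ℕ => -p ^ (2 * k + 1 + ν)) atTop (𝓝 0) := by
    simpa using ((tendsto_pow_atTop_nhds_zero_of_norm_lt_one hp).comp
      (tendsto_atTop_mono (fun k => by lia : ∀ k : ℕ, k ≤ 2 * k + 1 + ν) tendsto_id)).neg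
  simpa [Pi.div_def] using
    h.div ((tendsto_one_sub_pow hp 0).mul (tendsto_one_sub_pow hp ν)) (by simp)

/-! ### Euler's product and the transformed series -/

/-- Euler's series, the power series of the product `(-z; p)_∞`. -/
noncomputable def eulerSeries (p z : ℂ) : ℂ := ∑' m, eulerCoeff p m * z ^ m

/-- The entire function `z ↦ ∑ (-1) ^ k p ^ (k (k + ν)) z ^ k / ((p; p)_k (p; p)_{k + ν})`. -/
noncomputable def entireSeries (p : ℂ) (ν : ℕ) (z : ℂ) : ℂ := ∑' k, entireCoeff p ν k * z ^ k

lemma differentiable_eulerSeries {p : ℂ} (hp : ‖p‖ < 1) : Differentiable ℂ (eulerSeries p) :=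
  differentiable_tsum_mul_pow (summable_norm_eulerCoeff hp)

lemma differentiable_entireSeries {p : ℂ} (hp : ‖p‖ < 1) (ν : ℕ) :
    Differentiable ℂ (entireSeries p ν) :=
  differentiable_tsum_mul_pow (summable_norm_entireCoeff hp ν)

lemma eulerSeries_zero (p : ℂ) : eulerSeries p 0 = 1 := by
  rw [eulerSeries, tsum_eq_single 0 (fun n hn => by simp [hn])]
  simp [eulerCoeff_zero]

lemma eulerSeries_eq {p : ℂ} (hp : ‖p‖ < 1) (z : ℂ) :
    eulerSeries p z = (1 + z) * eulerSeries p (p * z) := by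
  have h1 := (summable_norm_eulerCoeff hp z).of_norm
  have h2 := (summable_norm_eulerCoeff hp (p * z)).of_norm
  rw [add_mul, one_mul, eulerSeries, eulerSeries, h1.tsum_eq_zero_add]
  conv_rhs => lhs; rw [h2.tsum_eq_zero_add]
  rw [← tsum_mul_left, add_assoc,
    ← ((summable_nat_add_iff 1).mpr h2).tsum_add (h2.mul_left z)]
  simp only [pow_zero]
  congr 2
  ext m
  have h := one_sub_pow_succ_ne_zero hp m
  rw [eulerCoeff_succ hp]
  field_simp
  ring

lemma eulerSeries_eq_prod_mul {p : ℂ} (hp : ‖p‖ < 1) (z : ℂ) (N : ℕ) :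
    eulerSeries p z = (∏ i ∈ Finset.range N, (1 + z * p ^ i)) * eulerSeries p (p ^ N * z) := by
  induction N with
  | zero => simp
  | succ N ih =>
    rw [ih, Finset.prod_range_succ, eulerSeries_eq hp (p ^ N * z)]
    ring_nf

lemma summable_norm_mul_pow {p : ℂ} (hp : ‖p‖ < 1) (z : ℂ) :
    Summable fun i : ℕ => ‖z * p ^ i‖ := by
  simp_rw [norm_mul, norm_pow]
  exact (summable_geometric_of_lt_one (norm_nonneg _) hp).mul_left _

lemma multipliable_one_add_mul_pow {p : ℂ} (hp : ‖p‖ < 1) (z : ℂ) :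
    Multipliable fun i : ℕ => 1 + z * p ^ i :=
  multipliable_one_add_of_summable (summable_norm_mul_pow hp z)

/-- Euler's identity. The functional equation of `eulerSeries` is iterated until the argument
tends to `0`. -/
lemma qPochInf_neg_eq_eulerSeries {p : ℂ} (hp : ‖p‖ < 1) (z : ℂ) :
    qPochInf (-z) p = eulerSeries p z := by
  have h1 := (multipliable_one_add_mul_pow hp z).hasProd.tendsto_prod_nat
  have h2 : Tendsto (fun N : ℕ => eulerSeries p (p ^ N * z)) atTop (𝓝 1) := by
    have := ((differentiable_eulerSeries hp).continuous.tendsto (0 * z)).comp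
      ((tendsto_pow_atTop_nhds_zero_of_norm_lt_one hp).mul_const z)
    simpa [Function.comp_def, eulerSeries_zero] using this
  have h3 := h1.mul h2
  simp_rw [← eulerSeries_eq_prod_mul hp z, mul_one] at h3
  rw [tendsto_nhds_unique tendsto_const_nhds h3, qPochInf]
  simp

lemma qPochInf_neg_ne_zero {p z : ℂ} (hp : ‖p‖ < 1) (h : ∀ i : ℕ, 1 + z * p ^ i ≠ 0) :
    qPochInf (-z) p ≠ 0 := by
  simpa [qPochInf] using tprod_one_add_ne_zero_of_summable h (summable_norm_mul_pow hp z)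

lemma eulerSeries_ne_zero {p z : ℂ} (hp : ‖p‖ < 1) (h : ∀ i : ℕ, 1 + z * p ^ i ≠ 0) :
    eulerSeries p z ≠ 0 := by
  rw [← qPochInf_neg_eq_eulerSeries hp]
  exact qPochInf_neg_ne_zero hp h

lemma eulerSeries_ne_zero_of_norm_lt_one {p z : ℂ} (hp : ‖p‖ < 1) (hz : ‖z‖ < 1) :
    eulerSeries p z ≠ 0 := by
  refine eulerSeries_ne_zero hp fun i h => ?_
  have h1 : ‖z * p ^ i‖ < 1 := by
    rw [norm_mul, norm_pow]
    exact (mul_le_of_le_one_right (norm_nonneg _) (pow_le_one₀ (norm_nonneg _) hp.le)).trans_lt hz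
  rw [eq_neg_of_add_eq_zero_right h, norm_neg, norm_one] at h1
  exact lt_irrefl _ h1

lemma eulerSeries_mul_tsum_besselCoeff {p z : ℂ} (hp : ‖p‖ < 1) (hz : ‖z‖ < 1) (ν : ℕ) :
    eulerSeries p z * ∑' j, besselCoeff p ν j * z ^ j = entireSeries p ν z := by
  rw [eulerSeries, tsum_mul_tsum_eq_tsum_sum_antidiagonal_of_summable_norm
    (summable_norm_eulerCoeff hp z) (summable_norm_besselCoeff hp ν hz), entireSeries]
  congr 1
  ext n
  have h := congrArg (PowerSeries.coeff n) (mk_eulerCoeff_mul_mk_besselCoeff hp ν)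
  rw [PowerSeries.coeff_mul, PowerSeries.coeff_mk] at h
  rw [← h, Finset.sum_mul]
  refine Finset.sum_congr rfl fun x hx => ?_
  rw [← Finset.HasAntidiagonal.mem_antidiagonal.mp hx, pow_add]
  simp only [PowerSeries.coeff_mk]
  ring

/-! ### The meromorphic continuation -/

/-- Meromorphic functions on the plane in normal form are determined by their germ at a point. -/
lemma MeromorphicNFOn.eq_of_eventuallyEq {f g : ℂ → ℂ} (hf : MeromorphicNFOn f Set.univ)
    (hg : MeromorphicNFOn g Set.univ) {x : ℂ} (h : f =ᶠ[𝓝 x] g) : f = g := by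
  have hs : MeromorphicOn (f - g) Set.univ := hf.meromorphicOn.sub hg.meromorphicOn
  have h0 : meromorphicOrderAt (f - g) x = ⊤ := by
    rw [meromorphicOrderAt_eq_top_iff]
    filter_upwards [h.filter_mono nhdsWithin_le_nhds] with y hy
    simp [hy]
  funext y
  have hy : meromorphicOrderAt (f - g) y = ⊤ := by
    by_contra hne
    exact hs.meromorphicOrderAt_ne_top_of_isPreconnected isPreconnected_univ
      (Set.mem_univ y) (Set.mem_univ x) hne h0
  rw [meromorphicOrderAt_eq_top_iff] at hy
  have h1 : f =ᶠ[𝓝[≠] y] g := by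
    filter_upwards [hy] with w hw using sub_eq_zero.mp hw
  exact (((hf (Set.mem_univ y)).eventuallyEq_nhdsNE_iff_eventuallyEq_nhds
    (hg (Set.mem_univ y))).mp h1).eq_of_nhds

lemma norm_sq_lt_one {q : ℂ} (hq : ‖q‖ < 1) : ‖q ^ 2‖ < 1 := by
  rw [norm_pow]
  exact pow_lt_one₀ (norm_nonneg _) hq two_ne_zero

lemma qBesselTerm_eq (q : ℂ) (ν : ℕ) (x : ℂ) (j : ℕ) :
    qBesselTerm q ν x j =
      (1 - q) ^ ν * x ^ ν * (besselCoeff (q ^ 2) ν j * ((1 - q) ^ 2 * x ^ 2) ^ j) := by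
  rw [qBesselTerm, besselCoeff, mul_pow, ← pow_mul, ← pow_mul]
  ring

lemma IsQBessel.unique {q : ℂ} {ν : ℕ} {J K : ℂ → ℂ} (hJ : IsQBessel q ν J)
    (hK : IsQBessel q ν K) : J = K := by
  refine hJ.meromorphic.eq_of_eventuallyEq hK.meromorphic (x := 0) ?_
  have h : ∀ᶠ x : ℂ in 𝓝 0, ‖(1 - q) * x‖ < 1 := by
    refine ContinuousAt.eventually_lt (by fun_prop) continuousAt_const ?_
    simp
  filter_upwards [h] with x hx using (hJ.hasSum x hx).unique (hK.hasSum x hx)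

/-- The quotient of entire functions which represents the `q`-Bessel function of order `ν` away
from the zeros of the denominator. -/
noncomputable def besselQuotient (q : ℂ) (ν : ℕ) (x : ℂ) : ℂ :=
  (1 - q) ^ ν * x ^ ν / eulerSeries (q ^ 2) ((1 - q) ^ 2 * x ^ 2) *
    entireSeries (q ^ 2) ν ((1 - q) ^ 2 * x ^ 2)

lemma analyticAt_eulerSeries_comp {q : ℂ} (hq : ‖q‖ < 1) (x : ℂ) :
    AnalyticAt ℂ (fun x => eulerSeries (q ^ 2) ((1 - q) ^ 2 * x ^ 2)) x :=
  Differentiable.analyticAt ((differentiable_eulerSeries (norm_sq_lt_one hq)).comp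
    (by fun_prop : Differentiable ℂ fun x : ℂ => (1 - q) ^ 2 * x ^ 2)) x

lemma analyticAt_entireSeries_comp {q : ℂ} (hq : ‖q‖ < 1) (ν : ℕ) (x : ℂ) :
    AnalyticAt ℂ (fun x => entireSeries (q ^ 2) ν ((1 - q) ^ 2 * x ^ 2)) x :=
  Differentiable.analyticAt ((differentiable_entireSeries (norm_sq_lt_one hq) ν).comp
    (by fun_prop : Differentiable ℂ fun x : ℂ => (1 - q) ^ 2 * x ^ 2)) x

lemma meromorphicOn_besselQuotient {q : ℂ} (hq : ‖q‖ < 1) (ν : ℕ) :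
    MeromorphicOn (besselQuotient q ν) Set.univ := fun x _ =>
  (((by fun_prop : AnalyticAt ℂ (fun x : ℂ => (1 - q) ^ ν * x ^ ν) x).meromorphicAt).div
    (analyticAt_eulerSeries_comp hq x).meromorphicAt).mul
      (analyticAt_entireSeries_comp hq ν x).meromorphicAt

lemma analyticAt_besselQuotient {q : ℂ} (hq : ‖q‖ < 1) (ν : ℕ) {x : ℂ}
    (h : eulerSeries (q ^ 2) ((1 - q) ^ 2 * x ^ 2) ≠ 0) :
    AnalyticAt ℂ (besselQuotient q ν) x :=
  ((by fun_prop : AnalyticAt ℂ (fun x : ℂ => (1 - q) ^ ν * x ^ ν) x).div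
    (analyticAt_eulerSeries_comp hq x) h).mul (analyticAt_entireSeries_comp hq ν x)

/-- Where the quotient is analytic, passing to normal form does not change its value. -/
lemma toMeromorphicNFOn_besselQuotient {q : ℂ} (hq : ‖q‖ < 1) (ν : ℕ) {x : ℂ}
    (h : eulerSeries (q ^ 2) ((1 - q) ^ 2 * x ^ 2) ≠ 0) :
    toMeromorphicNFOn (besselQuotient q ν) Set.univ x = besselQuotient q ν x := by
  rw [toMeromorphicNFOn_eq_toMeromorphicNFAt (meromorphicOn_besselQuotient hq ν) (Set.mem_univ x),
    toMeromorphicNFAt_eq_self.mpr (analyticAt_besselQuotient hq ν h).meromorphicNFAt]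

lemma norm_sq_mul_sq_lt_one {q x : ℂ} (hx : ‖(1 - q) * x‖ < 1) :
    ‖(1 - q) ^ 2 * x ^ 2‖ < 1 := by
  rw [← mul_pow]
  exact norm_sq_lt_one hx

lemma hasSum_qBesselTerm {q : ℂ} (hq : ‖q‖ < 1) (ν : ℕ) {x : ℂ} (hx : ‖(1 - q) * x‖ < 1) :
    HasSum (qBesselTerm q ν x) (besselQuotient q ν x) := by
  have hz := norm_sq_mul_sq_lt_one hx
  have hp := norm_sq_lt_one hq
  have h0 := eulerSeries_ne_zero_of_norm_lt_one hp hz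
  have h1 := ((summable_norm_besselCoeff hp ν hz).of_norm.hasSum).mul_left ((1 - q) ^ ν * x ^ ν)
  rw [funext (qBesselTerm_eq q ν x), besselQuotient, ← eulerSeries_mul_tsum_besselCoeff hp hz ν]
  rwa [div_mul_eq_mul_div, mul_div_assoc, mul_div_cancel_left₀ _ h0]

lemma isQBessel_toMeromorphicNFOn {q : ℂ} (hq : ‖q‖ < 1) (ν : ℕ) :
    IsQBessel q ν (toMeromorphicNFOn (besselQuotient q ν) Set.univ) where
  meromorphic := meromorphicNFOn_toMeromorphicNFOn _ _
  hasSum x hx := by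
    rw [toMeromorphicNFOn_besselQuotient hq ν
      (eulerSeries_ne_zero_of_norm_lt_one (norm_sq_lt_one hq) (norm_sq_mul_sq_lt_one hx))]
    exact hasSum_qBesselTerm hq ν hx

lemma isQBessel_qBessel {q : ℂ} (hq : ‖q‖ < 1) (ν : ℕ) : IsQBessel q ν (qBessel q ν) := by
  have h : ∃ J, IsQBessel q ν J := ⟨_, isQBessel_toMeromorphicNFOn hq ν⟩
  rw [qBessel, dif_pos h]
  exact h.choose_spec

lemma qBessel_eq_besselQuotient {q : ℂ} (hq : ‖q‖ < 1) (ν : ℕ) {x : ℂ}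
    (h : eulerSeries (q ^ 2) ((1 - q) ^ 2 * x ^ 2) ≠ 0) :
    qBessel q ν x = besselQuotient q ν x := by
  rw [(isQBessel_qBessel hq ν).unique (isQBessel_toMeromorphicNFOn hq ν),
    toMeromorphicNFOn_besselQuotient hq ν h]

lemma entireCoeff_sq_mul_pow (q : ℂ) (ν : ℕ) (x : ℂ) (k : ℕ) :
    entireCoeff (q ^ 2) ν k * ((1 - q) ^ 2 * x ^ 2) ^ k =
      (-1) ^ k * q ^ (2 * k * (k + ν)) * (1 - q) ^ (2 * k) /
        (qPoch (q ^ 2) (q ^ 2) k * qPoch (q ^ 2) (q ^ 2) (k + ν)) * x ^ (2 * k) := by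
  rw [entireCoeff, mul_pow, ← pow_mul, ← pow_mul, ← pow_mul, mul_assoc 2 k]
  ring

/-- The representation of the `q`-Bessel function as a quotient of entire functions. -/
lemma qBessel_eq_transformed {q : ℂ} (hq : ‖q‖ < 1) (ν : ℕ) (x : ℂ) :
    Multipliable (fun i : ℕ => 1 - (-((1 - q) ^ 2 * x ^ 2)) * (q ^ 2) ^ i) ∧
      Summable (fun k : ℕ => (-1) ^ k * q ^ (2 * k * (k + ν)) * (1 - q) ^ (2 * k) /
        (qPoch (q ^ 2) (q ^ 2) k * qPoch (q ^ 2) (q ^ 2) (k + ν)) * x ^ (2 * k)) ∧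
      ((∀ i : ℕ, 1 + (1 - q) ^ 2 * x ^ 2 * q ^ (2 * i) ≠ 0) →
        qPochInf (-((1 - q) ^ 2 * x ^ 2)) (q ^ 2) ≠ 0 ∧
        qBessel q ν x =
          (1 - q) ^ ν * x ^ ν / qPochInf (-((1 - q) ^ 2 * x ^ 2)) (q ^ 2) *
            ∑' k : ℕ, (-1) ^ k * q ^ (2 * k * (k + ν)) * (1 - q) ^ (2 * k) /
              (qPoch (q ^ 2) (q ^ 2) k * qPoch (q ^ 2) (q ^ 2) (k + ν)) * x ^ (2 * k)) := by
  have hp := norm_sq_lt_one hq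
  simp_rw [← entireCoeff_sq_mul_pow, pow_mul q 2]
  refine ⟨?_, (summable_norm_entireCoeff hp ν _).of_norm, fun h => ?_⟩
  · simpa using multipliable_one_add_mul_pow hp ((1 - q) ^ 2 * x ^ 2)
  · rw [qPochInf_neg_eq_eulerSeries hp]
    have h0 := eulerSeries_ne_zero hp h
    exact ⟨h0, qBessel_eq_besselQuotient hq ν h0⟩

/-! ### Power series with coefficients depending on `q`, near `q = 0` -/

lemma eventually_norm_lt_one_and_ne_zero : ∀ᶠ q : ℂ in 𝓝[≠] 0, ‖q‖ < 1 ∧ q ≠ 0 := by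
  filter_upwards [(eventually_norm_sub_lt (0 : ℂ) one_pos).filter_mono nhdsWithin_le_nhds,
    self_mem_nhdsWithin] with q hq hq0
  exact ⟨by simpa using hq, hq0⟩

lemma HasLeadingTerm.of_differentiableAt {F G : ℂ → ℂ} {s c : ℂ} {e : ℤ}
    (hG : DifferentiableAt ℂ G 0) (hc : G 0 = c)
    (h : ∀ᶠ q in 𝓝[≠] (0 : ℂ), F q = s * q ^ e * G q) : HasLeadingTerm F s e c := by
  subst hc
  refine ⟨fun q => G q - G 0, ?_, ?_⟩
  · simpa using hG.isBigO_sub.mono (nhdsWithin_le_nhds (s := {0}ᶜ))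
  · filter_upwards [h] with q hq
    rw [hq]
    ring

/-- On the disc of radius `1 / 4` the series is dominated by a geometric series of ratio
`3 / 4`, so it is analytic; an expansion `F q = F 0 + O(q)` then comes from differentiability. -/
lemma differentiableAt_tsum_mul_pow_zero {a : ℕ → ℂ → ℂ} {E : ℕ → ℕ} {C : ℝ} {M : ℕ}
    (ha : ∀ k, DifferentiableOn ℂ (a k) (Metric.ball 0 (1 / 4)))
    (hC : ∀ k, ∀ q ∈ Metric.ball (0 : ℂ) (1 / 4), ‖a k q‖ ≤ C * 3 ^ k)
    (hE : ∀ k, k ≤ E k + M) :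
    DifferentiableAt ℂ (fun q => ∑' k, a k q * q ^ E k) 0 := by
  have h3 : Summable fun k : ℕ => C * 4 ^ M * (3 / 4 : ℝ) ^ k :=
    (summable_geometric_of_lt_one (by norm_num) (by norm_num)).mul_left _
  refine (Complex.differentiableOn_tsum_of_summable_norm h3 (fun k => ?_)
    Metric.isOpen_ball (U := Metric.ball 0 (1 / 4)) ?_).differentiableAt
    (Metric.isOpen_ball.mem_nhds (by simp))
  · exact (ha k).mul (by fun_prop)
  · intro k q hq
    have hq' : ‖q‖ ≤ 1 / 4 := (mem_ball_zero_iff.mp hq).le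
    have h1 : ‖q ^ E k‖ ≤ 4 ^ M * (1 / 4 : ℝ) ^ k := by
      rw [norm_pow]
      calc ‖q‖ ^ E k ≤ (1 / 4 : ℝ) ^ E k := by gcongr
        _ = 4 ^ M * (1 / 4 : ℝ) ^ (E k + M) := by
          rw [pow_add, mul_left_comm, ← mul_pow]; norm_num
        _ ≤ 4 ^ M * (1 / 4 : ℝ) ^ k := by
          gcongr 4 ^ M * ?_
          exact pow_le_pow_of_le_one (by norm_num) (by norm_num) (hE k)
    calc ‖a k q * q ^ E k‖ = ‖a k q‖ * ‖q ^ E k‖ := norm_mul _ _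
      _ ≤ (C * 3 ^ k) * (4 ^ M * (1 / 4 : ℝ) ^ k) :=
        mul_le_mul (hC k q hq) h1 (norm_nonneg _) ((norm_nonneg _).trans (hC k q hq))
      _ = C * 4 ^ M * (3 / 4 : ℝ) ^ k := by
        rw [show (3 / 4 : ℝ) = 3 * (1 / 4) by norm_num, mul_pow]; ring

lemma norm_lt_one_of_mem_ball {q : ℂ} (hq : q ∈ Metric.ball (0 : ℂ) (1 / 4)) : ‖q‖ < 1 :=
  (mem_ball_zero_iff.mp hq).trans (by norm_num)

lemma norm_inv_qPoch_le {q : ℂ} (hq : q ∈ Metric.ball (0 : ℂ) (1 / 4)) (k : ℕ) :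
    ‖(qPoch (q ^ 2) (q ^ 2) k)⁻¹‖ ≤ (16 / 15) ^ k := by
  have hq' : ‖q‖ < 1 / 4 := mem_ball_zero_iff.mp hq
  rw [qPoch, ← Finset.prod_inv_distrib, norm_prod]
  refine (Finset.prod_le_prod (g := fun _ => (16 / 15 : ℝ)) (fun _ _ => norm_nonneg _)
    fun i _ => ?_).trans_eq (by rw [Finset.prod_const, Finset.card_range])
  have h1 : ‖q ^ 2 * (q ^ 2) ^ i‖ ≤ 1 / 16 := by
    rw [norm_mul, norm_pow, norm_pow, norm_pow]
    have h2 : ‖q‖ ^ 2 ≤ (1 / 4) ^ 2 := by gcongr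
    have h3 : (‖q‖ ^ 2) ^ i ≤ 1 := pow_le_one₀ (by positivity) (h2.trans (by norm_num))
    nlinarith [sq_nonneg ‖q‖]
  have h2 := norm_sub_norm_le (1 : ℂ) (q ^ 2 * (q ^ 2) ^ i)
  rw [norm_one] at h2
  rw [norm_inv, inv_le_comm₀ (by linarith) (by norm_num)]
  norm_num
  linarith

lemma norm_one_sub_pow_le {q : ℂ} (hq : q ∈ Metric.ball (0 : ℂ) (1 / 4)) (k : ℕ) :
    ‖(1 - q) ^ (2 * k)‖ ≤ (25 / 16) ^ k := by
  have hq' : ‖q‖ < 1 / 4 := mem_ball_zero_iff.mp hq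
  have h1 : ‖1 - q‖ ≤ 5 / 4 := by
    have := norm_sub_le (1 : ℂ) q
    rw [norm_one] at this
    linarith
  rw [norm_pow, show (25 / 16 : ℝ) = (5 / 4) ^ 2 by norm_num, ← pow_mul]
  gcongr

lemma differentiableOn_qPoch (k : ℕ) (s : Set ℂ) :
    DifferentiableOn ℂ (fun q => qPoch (q ^ 2) (q ^ 2) k) s := by
  unfold qPoch
  fun_prop

lemma qPoch_sq_ne_zero {q : ℂ} (hq : ‖q‖ < 1) (k : ℕ) : qPoch (q ^ 2) (q ^ 2) k ≠ 0 :=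
  qPoch_self_ne_zero (norm_sq_lt_one hq) k

lemma qPoch_sq_zero (k : ℕ) : qPoch ((0 : ℂ) ^ 2) (0 ^ 2) k = 1 := by simp [qPoch]

/-! ### The denominator near `q = 0` -/

/-- Euler's series at `z = (1 - q) ^ 2 q ^ 2`, that is, the product of the factors of
`(-(1 - q) ^ 2 q ^ (2 n); q ^ 2)_∞` in which the exponent of `q` is positive. -/
lemma differentiableAt_eulerSeries_sq :
    DifferentiableAt ℂ (fun q => eulerSeries (q ^ 2) ((1 - q) ^ 2 * q ^ 2)) 0 := by
  have h := differentiableAt_tsum_mul_pow_zero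
    (a := fun k q => (1 - q) ^ (2 * k) / qPoch (q ^ 2) (q ^ 2) k)
    (E := fun k => 2 * k.choose 2 + 2 * k) (C := 1) (M := 0)
    (fun k => DifferentiableOn.div (by fun_prop) (differentiableOn_qPoch k _)
      fun q hq => qPoch_sq_ne_zero (norm_lt_one_of_mem_ball hq) k)
    (fun k q hq => ?_) (fun k => by lia)
  · convert h using 3 with q
    refine tsum_congr fun k => ?_
    rw [eulerCoeff, mul_pow, ← pow_mul, ← pow_mul, ← pow_mul, pow_add]
    ring
  · rw [div_eq_mul_inv, norm_mul, one_mul]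
    calc _ ≤ (25 / 16 : ℝ) ^ k * (16 / 15) ^ k :=
          mul_le_mul (norm_one_sub_pow_le hq k) (norm_inv_qPoch_le hq k) (norm_nonneg _)
            (by positivity)
      _ ≤ 3 ^ k := by
        rw [← mul_pow]
        gcongr
        norm_num

/-- Each step of the induction pulls one factor `1 + (1 - q) ^ 2 q ^ (-2 (m + 1))`, of
leading term `q ^ (-2 (m + 1))`, out of the product. The value `2` at `q = 0` is that of the factor
`1 + (1 - q) ^ 2`, in which the powers of `q` cancel. -/
lemma eulerSeries_zpow_asymptotic (m : ℕ) :
    ∃ D : ℂ → ℂ, DifferentiableAt ℂ D 0 ∧ D 0 = 2 ∧ ∀ᶠ q in 𝓝[≠] (0 : ℂ),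
      eulerSeries (q ^ 2) ((1 - q) ^ 2 * (q ^ (-(m : ℤ))) ^ 2) =
        q ^ (-((m : ℤ) * (m + 1))) * D q := by
  induction m with
  | zero =>
    refine ⟨fun q => (1 + (1 - q) ^ 2) * eulerSeries (q ^ 2) ((1 - q) ^ 2 * q ^ 2),
      DifferentiableAt.mul (by fun_prop) differentiableAt_eulerSeries_sq, ?_, ?_⟩
    · simp [eulerSeries_zero]; norm_num
    · filter_upwards [eventually_norm_lt_one_and_ne_zero] with q ⟨hq, _⟩
      rw [eulerSeries_eq (norm_sq_lt_one hq)]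
      simp [mul_comm]
  | succ m ih =>
    obtain ⟨D, hD, hD0, hDq⟩ := ih
    refine ⟨fun q => (q ^ (2 * (m + 1)) + (1 - q) ^ 2) * D q,
      DifferentiableAt.mul (by fun_prop) hD, ?_, ?_⟩
    · simp [hD0]
    · filter_upwards [eventually_norm_lt_one_and_ne_zero, hDq] with q ⟨hq, hq0⟩ hDq
      have h1 : q ^ 2 * ((1 - q) ^ 2 * (q ^ (-((m + 1 : ℕ) : ℤ))) ^ 2) =
          (1 - q) ^ 2 * (q ^ (-(m : ℤ))) ^ 2 := by
        simp only [zpow_neg, zpow_natCast]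
        field_simp
        ring
      rw [eulerSeries_eq (norm_sq_lt_one hq), h1, hDq,
        show -(((m + 1 : ℕ) : ℤ) * ((m + 1 : ℕ) + 1)) =
          -((m : ℤ) * (m + 1)) + -((2 * (m + 1) : ℕ) : ℤ) by push_cast; ring, zpow_add₀ hq0]
      simp only [zpow_neg _ ((_ : ℕ) : ℤ), zpow_natCast]
      field_simp
      ring

/-! ### The numerator near `q = 0` -/

/-- The part of the `k`-th coefficient of the transformed series which is analytic and nonzero
at `q = 0`. -/
noncomputable def coeffUnit (ν k : ℕ) (q : ℂ) : ℂ :=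
  (1 - q) ^ (2 * k) / (qPoch (q ^ 2) (q ^ 2) k * qPoch (q ^ 2) (q ^ 2) (k + ν))

lemma coeffUnit_zero (ν k : ℕ) : coeffUnit ν k 0 = 1 := by
  rw [coeffUnit, qPoch_sq_zero, qPoch_sq_zero]
  simp

lemma differentiableOn_coeffUnit (ν k : ℕ) :
    DifferentiableOn ℂ (coeffUnit ν k) (Metric.ball 0 (1 / 4)) :=
  DifferentiableOn.div (by fun_prop) ((differentiableOn_qPoch k _).mul (differentiableOn_qPoch _ _))
    fun _ hq => mul_ne_zero (qPoch_sq_ne_zero (norm_lt_one_of_mem_ball hq) _)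
      (qPoch_sq_ne_zero (norm_lt_one_of_mem_ball hq) _)

lemma differentiableAt_coeffUnit (ν k : ℕ) : DifferentiableAt ℂ (coeffUnit ν k) 0 :=
  (differentiableOn_coeffUnit ν k).differentiableAt (Metric.isOpen_ball.mem_nhds (by simp))

lemma norm_coeffUnit_le (ν k : ℕ) {q : ℂ} (hq : q ∈ Metric.ball (0 : ℂ) (1 / 4)) :
    ‖coeffUnit ν k q‖ ≤ (16 / 15) ^ ν * 3 ^ k := by
  rw [coeffUnit, div_eq_mul_inv, mul_inv, norm_mul, norm_mul]
  calc _ ≤ (25 / 16 : ℝ) ^ k * ((16 / 15) ^ k * (16 / 15) ^ (k + ν)) := by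
        gcongr
        · exact norm_one_sub_pow_le hq k
        · exact norm_inv_qPoch_le hq k
        · exact norm_inv_qPoch_le hq _
    _ = (16 / 15) ^ ν * (25 / 16 * (16 / 15) * (16 / 15)) ^ k := by
      rw [pow_add, mul_pow, mul_pow]; ring
    _ ≤ _ := by gcongr; norm_num

lemma differentiableAt_tsum_coeffUnit (ν : ℕ) {c : ℕ → ℂ} {E : ℕ → ℕ} {M : ℕ}
    (hc : ∀ k, ‖c k‖ ≤ 1) (hE : ∀ k, k ≤ E k + M) :
    DifferentiableAt ℂ (fun q => ∑' k, c k * coeffUnit ν k q * q ^ E k) 0 := by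
  refine differentiableAt_tsum_mul_pow_zero (C := (16 / 15) ^ ν) (M := M)
    (fun k => (differentiableOn_coeffUnit ν k).const_mul _) (fun k q hq => ?_) hE
  rw [norm_mul]
  exact (mul_le_of_le_one_left (norm_nonneg _) (hc k)).trans (norm_coeffUnit_le ν k hq)

/-- The terms of the numerator series at `x = q ^ n`, with the power of `q` collected. -/
lemma entireCoeff_mul_zpow_pow {q : ℂ} (hq : q ≠ 0) (ν : ℕ) (n : ℤ) (k : ℕ) :
    entireCoeff (q ^ 2) ν k * ((1 - q) ^ 2 * (q ^ n) ^ 2) ^ k =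
      (-1) ^ k * coeffUnit ν k q * q ^ (2 * (k : ℤ) * (k + ν + n)) := by
  have h1 : q ^ (2 * (k : ℤ) * (k + ν + n)) = (q ^ 2) ^ (k * (k + ν)) * ((q ^ n) ^ 2) ^ k := by
    rw [← zpow_natCast, ← zpow_natCast, ← zpow_natCast, ← zpow_natCast, ← zpow_mul, ← zpow_mul,
      ← zpow_mul, ← zpow_add₀ hq]
    congr 1
    push_cast
    ring
  rw [h1, entireCoeff, coeffUnit, mul_pow, ← pow_mul (1 - q)]
  ring

/-- For `n ≤ 0` the leading term of `J_ν(q ^ n)` follows from that of the numerator series. -/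
lemma hasLeadingTerm_qBessel_of_entireSeries {ν : ℕ} {n e e' : ℤ} {s c : ℂ} {A : ℂ → ℂ}
    (hn : n ≤ 0) (hA : DifferentiableAt ℂ A 0)
    (h : ∀ᶠ q in 𝓝[≠] (0 : ℂ),
      entireSeries (q ^ 2) ν ((1 - q) ^ 2 * (q ^ n) ^ 2) = s * q ^ e * A q)
    (he : e' = n * (n + ν - 1) + e) (hc : A 0 / 2 = c) :
    HasLeadingTerm (fun q => qBessel q ν (q ^ n)) s e' c := by
  obtain ⟨m, rfl⟩ : ∃ m : ℕ, n = -m := ⟨n.natAbs, by lia⟩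
  obtain ⟨D, hD, hD0, hDq⟩ := eulerSeries_zpow_asymptotic m
  have hD0' : D 0 ≠ 0 := by simp [hD0]
  have hDne : ∀ᶠ q in 𝓝[≠] (0 : ℂ), D q ≠ 0 :=
    (hD.continuousAt.eventually_ne hD0').filter_mono nhdsWithin_le_nhds
  have hG : DifferentiableAt ℂ (fun q => (1 - q) ^ ν * A q / D q) 0 :=
    DifferentiableAt.div (DifferentiableAt.mul (by fun_prop) hA) hD hD0'
  have hG0 : (1 - (0 : ℂ)) ^ ν * A 0 / D 0 = c := by simp [hD0, hc]
  refine HasLeadingTerm.of_differentiableAt hG hG0 ?_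
  filter_upwards [h, hDq, hDne, eventually_norm_lt_one_and_ne_zero] with q hq hDq hDne hq1
  have hz : ∀ k : ℤ, q ^ k ≠ 0 := fun k => zpow_ne_zero k hq1.2
  have h0 : eulerSeries (q ^ 2) ((1 - q) ^ 2 * (q ^ (-(m : ℤ))) ^ 2) ≠ 0 := by
    rw [hDq]
    exact mul_ne_zero (hz _) hDne
  rw [qBessel_eq_besselQuotient hq1.1 ν h0, besselQuotient, hq, hDq, he,
    show -(m : ℤ) * (-m + ν - 1) + e = (-(m : ℤ)) * ν - (-((m : ℤ) * (m + 1))) + e by ring,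
    zpow_add₀ hq1.2, zpow_sub₀ hq1.2, zpow_mul, zpow_natCast]
  have h2 := hz (-((m : ℤ) * (m + 1)))
  field_simp

/-! ### The leading terms -/

lemma hasLeadingTerm_qBessel_of_pos (ν : ℕ) {n : ℤ} (hn : 1 ≤ n) :
    HasLeadingTerm (fun q => qBessel q ν (q ^ n)) 1 (n * ν) 1 := by
  obtain ⟨m, rfl⟩ : ∃ m : ℕ, n = m := ⟨n.natAbs, by lia⟩
  have hm : 1 ≤ m := by exact_mod_cast hn
  have hE : ∀ k, k ≤ 2 * m * k + 0 := fun k => by nlinarith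
  have hdiff := differentiableAt_tsum_coeffUnit ν (c := fun k => (-1) ^ k) (by simp) hE
  have hG : DifferentiableAt ℂ (fun q => (1 - q) ^ ν *
      ∑' k, (-1) ^ k * coeffUnit ν k q * q ^ (2 * m * k)) 0 :=
    DifferentiableAt.mul (by fun_prop) hdiff
  have hG0 : (1 - (0 : ℂ)) ^ ν * ∑' k, (-1) ^ k * coeffUnit ν k 0 * 0 ^ (2 * m * k) = 1 := by
    rw [tsum_eq_single 0 fun k hk => by simp [hk, Nat.ne_of_gt hm]]
    simp [coeffUnit_zero]
  refine HasLeadingTerm.of_differentiableAt hG hG0 ?_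
  have hsmall : ∀ᶠ q : ℂ in 𝓝[≠] 0, ‖(1 - q) * q ^ m‖ < 1 := by
    refine (ContinuousAt.eventually_lt (by fun_prop) continuousAt_const ?_).filter_mono
      nhdsWithin_le_nhds
    simp [Nat.ne_of_gt hm]
  filter_upwards [hsmall, eventually_norm_lt_one_and_ne_zero] with q hq hq1
  have h1 := ((isQBessel_qBessel hq1.1 ν).hasSum (q ^ m) hq).tsum_eq
  rw [zpow_natCast, ← h1, one_mul, show ((m : ℤ) * ν) = ((m * ν : ℕ) : ℤ) by push_cast; rfl,
    zpow_natCast, ← mul_assoc, ← tsum_mul_left]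
  refine tsum_congr fun k => ?_
  rw [qBesselTerm, coeffUnit, add_comm k ν, ← pow_mul, ← pow_mul]
  ring

/-- The bound which makes the exponents `2 k (k + ν + n) - e` grow at least linearly. -/
lemma le_toNat_add (l e : ℤ) (k : ℕ) :
    k ≤ (2 * (k : ℤ) * (k + l) - e).toNat + ((2 * l - 1) ^ 2 + |e|).toNat := by
  have h1 := Int.self_le_toNat (2 * (k : ℤ) * (k + l) - e)
  have h2 := Int.self_le_toNat ((2 * l - 1) ^ 2 + |e|)
  have h3 := le_abs_self e
  zify
  nlinarith [sq_nonneg (2 * (k : ℤ) + (2 * l - 1)), sq_nonneg (2 * l - 1)]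

lemma neg_one_pow_mul_zpow_eq {q : ℂ} (hq : q ≠ 0) (u : ℂ) (r k : ℕ) (e f : ℤ) :
    (-1) ^ k * u * q ^ f = (-1) ^ r * q ^ e * ((-1) ^ (r + k) * u * q ^ (f - e)) := by
  have h1 : ((-1 : ℂ) ^ r) * (-1) ^ r = 1 := by rw [← mul_pow]; simp
  have h2 : q ^ e * q ^ (f - e) = q ^ f := by rw [← zpow_add₀ hq, add_sub_cancel]
  rw [← h2, pow_add]
  linear_combination (-(-1) ^ k * u * q ^ e * q ^ (f - e)) * h1

/-- The case in which the numerator series has a single dominant term, of index `r` and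
exponent `e`. The denominator contributes the factor `1 / 2`. -/
lemma hasLeadingTerm_qBessel_of_dominant {ν r : ℕ} {n e e' : ℤ} (hn : n ≤ 0)
    (hmin : ∀ k : ℕ, e ≤ 2 * (k : ℤ) * (k + ν + n))
    (hr : ∀ k : ℕ, 2 * (k : ℤ) * (k + ν + n) = e ↔ k = r)
    (he : e' = n * (n + ν - 1) + e) :
    HasLeadingTerm (fun q => qBessel q ν (q ^ n)) ((-1) ^ r) e' (1 / 2) := by
  set E : ℕ → ℕ := fun k => (2 * (k : ℤ) * (k + (ν + n)) - e).toNat with hEdef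
  have hE' : ∀ k, (E k : ℤ) = 2 * (k : ℤ) * (k + ν + n) - e := fun k => by
    simp only [hEdef, ← add_assoc]
    exact Int.toNat_of_nonneg (sub_nonneg.mpr (hmin k))
  have hdiff := differentiableAt_tsum_coeffUnit ν (c := fun k => (-1) ^ (r + k)) (by simp)
    (E := E) (le_toNat_add (ν + n) e)
  refine hasLeadingTerm_qBessel_of_entireSeries hn hdiff ?_ he ?_
  · filter_upwards [eventually_norm_lt_one_and_ne_zero] with q hq
    rw [entireSeries, ← tsum_mul_left]
    refine tsum_congr fun k => ?_
    rw [entireCoeff_mul_zpow_pow hq.2, ← zpow_natCast q (E k), hE']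
    exact neg_one_pow_mul_zpow_eq hq.2 _ _ _ _ _
  · rw [tsum_eq_single r fun k hk => ?_]
    · have h0 : E r = 0 := by
        have := (hr r).mpr rfl
        have := hE' r
        lia
      simp [h0, coeffUnit_zero, ← two_mul]
    · have h0 : E k ≠ 0 := fun h => hk <| (hr k).mp <| by
        have h1 := hE' k
        rw [h, Nat.cast_zero] at h1
        linarith
      simp [h0]

/-- The two dominant terms of the odd case, which cancel to leading order. -/
lemma coeffUnit_sub_coeffUnit_succ (ν r : ℕ) {q : ℂ} (hq : ‖q‖ < 1) :
    coeffUnit ν r q - coeffUnit ν (r + 1) q = q * (coeffUnit ν r q *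
      (2 - q - q ^ (2 * r + 1) - q ^ (2 * (r + ν) + 1) + q ^ (2 * r + 1 + 2 * (r + ν + 1))) /
        ((1 - q ^ (2 * (r + 1))) * (1 - q ^ (2 * (r + ν + 1))))) := by
  have hp := norm_sq_lt_one hq
  have h1 := qPoch_self_ne_zero hp r
  have h2 := qPoch_self_ne_zero hp (r + ν)
  have h3 := one_sub_pow_succ_ne_zero hp r
  have h4 := one_sub_pow_succ_ne_zero hp (r + ν)
  rw [coeffUnit, coeffUnit, show r + 1 + ν = r + ν + 1 by ring, qPoch_self_succ, qPoch_self_succ]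
  rw [← pow_mul] at h3 h4 ⊢
  rw [← pow_mul]
  field_simp
  ring

/-- The case in which the terms of index `r` and `r + 1` of the numerator series have the same
exponent and opposite signs; all other exponents are larger by at least `4`. The difference of
the two terms is `2 q` to leading order, and the factor `2` cancels against the denominator. -/
lemma hasLeadingTerm_qBessel_of_odd {ν r : ℕ} {n : ℤ} (hn : n ≤ 0)
    (hr : n + ν = -(2 * (r : ℤ) + 1)) :
    HasLeadingTerm (fun q => qBessel q ν (q ^ n)) ((-1) ^ r)
      (n * (n + ν - 1) + (1 - 2 * (r : ℤ) * (r + 1))) 1 := by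
  -- One more than the common exponent `-2 r (r + 1)` of the two terms that cancel.
  set e : ℤ := 1 - 2 * (r : ℤ) * (r + 1) with he
  -- For `k = r` and `k = r + 1` the subtraction truncates; these indices do not use `E`.
  set E : ℕ → ℕ := fun k => (2 * (k : ℤ) * (k + (ν + n)) - e).toNat with hEdef
  have hE : ∀ k, k ∉ ({r, r + 1} : Finset ℕ) →
      (E k : ℤ) = 2 * (k : ℤ) * (k + ν + n) - e ∧ E k ≠ 0 := fun k hk => by
    have h1 : 2 * (k : ℤ) * (k + (ν + n)) - e = 2 * ((k : ℤ) - r) * (k - r - 1) - 1 := by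
      rw [add_comm (ν : ℤ) n, hr]; ring
    have h2 : (1 : ℤ) ≤ ((k : ℤ) - r) * (k - r - 1) := by
      simp only [Finset.mem_insert, Finset.mem_singleton, not_or] at hk
      rcases lt_or_gt_of_ne hk.1 with h | h
      · have h3 : (k : ℤ) - r ≤ -1 := by lia
        nlinarith
      · have h3 : (2 : ℤ) ≤ (k : ℤ) - r := by lia
        nlinarith
    have h3 : (E k : ℤ) = 2 * (k : ℤ) * (k + (ν + n)) - e := Int.toNat_of_nonneg (by lia)
    exact ⟨by rw [h3, add_assoc], by lia⟩
  -- The terms of index `r` and `r + 1` are taken out of the series: their sum is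
  -- `(-1) ^ r * q ^ e * w q`, with `w 0 = 2`.
  set c : ℕ → ℂ := fun k => if k ∈ ({r, r + 1} : Finset ℕ) then 0 else (-1) ^ (r + k) with hc
  have hdiff := differentiableAt_tsum_coeffUnit ν (c := c)
    (fun k => by rw [hc]; dsimp only; split_ifs <;> simp) (E := E) (le_toNat_add (ν + n) e)
  set w : ℂ → ℂ := fun q => coeffUnit ν r q *
      (2 - q - q ^ (2 * r + 1) - q ^ (2 * (r + ν) + 1) + q ^ (2 * r + 1 + 2 * (r + ν + 1))) /
        ((1 - q ^ (2 * (r + 1))) * (1 - q ^ (2 * (r + ν + 1)))) with hw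
  have hwdiff : DifferentiableAt ℂ w 0 :=
    (DifferentiableAt.mul (differentiableAt_coeffUnit ν r) (by fun_prop)).div (by fun_prop)
      (by simp)
  refine hasLeadingTerm_qBessel_of_entireSeries hn (hwdiff.add hdiff) ?_ rfl ?_
  · filter_upwards [eventually_norm_lt_one_and_ne_zero] with q hq
    have hsum := (summable_norm_entireCoeff (norm_sq_lt_one hq.1) ν
      ((1 - q) ^ 2 * (q ^ n) ^ 2)).of_norm
    set f : ℕ → ℂ := fun k => entireCoeff (q ^ 2) ν k * ((1 - q) ^ 2 * (q ^ n) ^ 2) ^ k with hf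
    have hfin : HasSum (fun k => if k ∈ ({r, r + 1} : Finset ℕ) then f k else 0)
        (f r + f (r + 1)) := by
      have h2 := hasSum_sum_of_ne_finset_zero (L := .unconditional ℕ) (s := ({r, r + 1} : Finset ℕ))
        (f := fun k => if k ∈ ({r, r + 1} : Finset ℕ) then f k else 0) fun k hk => if_neg hk
      rwa [Finset.sum_pair (by simp), if_pos (by simp), if_pos (by simp)] at h2
    have hrest : ∑' k, (f k - if k ∈ ({r, r + 1} : Finset ℕ) then f k else 0) =
        (-1) ^ r * q ^ e * ∑' k, c k * coeffUnit ν k q * q ^ E k := by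
      rw [← tsum_mul_left]
      refine tsum_congr fun k => ?_
      by_cases hk : k ∈ ({r, r + 1} : Finset ℕ)
      · simp only [hc, if_pos hk]
        ring
      · simp only [hc, if_neg hk]
        rw [hf]
        dsimp only
        rw [sub_zero, entireCoeff_mul_zpow_pow hq.2, ← zpow_natCast q (E k), (hE k hk).1]
        exact neg_one_pow_mul_zpow_eq hq.2 _ _ _ _ _
    have hmain : f r + f (r + 1) = (-1) ^ r * q ^ e * w q := by
      have h3 : ∀ k : ℤ, k = r ∨ k = r + 1 → 2 * k * (k + ν + n) = e - 1 := by
        rintro k (rfl | rfl)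
        · rw [add_assoc, add_comm (ν : ℤ) n, hr, he]; ring
        · rw [add_assoc, add_comm (ν : ℤ) n, hr, he]; ring
      rw [hf]
      dsimp only
      rw [entireCoeff_mul_zpow_pow hq.2, entireCoeff_mul_zpow_pow hq.2, h3 _ (Or.inl rfl),
        h3 _ (Or.inr (by push_cast; rfl)), zpow_sub_one₀ hq.2, pow_succ]
      have h4 := coeffUnit_sub_coeffUnit_succ ν r hq.1
      rw [hw]
      have h5 : q * q⁻¹ = 1 := mul_inv_cancel₀ hq.2
      linear_combination ((-1) ^ r * q ^ e * q⁻¹) * h4 + ((-1) ^ r * q ^ e * w q) * h5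
    rw [entireSeries, Pi.add_apply, mul_add, ← hmain, ← hrest, hsum.tsum_sub hfin.summable,
      hfin.tsum_eq]
    ring
  · have h0 : ∑' k, c k * coeffUnit ν k 0 * (0 : ℂ) ^ E k = 0 := by
      refine (tsum_congr fun k => ?_).trans tsum_zero
      by_cases hk : k ∈ ({r, r + 1} : Finset ℕ)
      · rw [show c k = 0 from if_pos hk, zero_mul, zero_mul]
      · simp [(hE k hk).2]
    rw [Pi.add_apply, h0, hw]
    simp [coeffUnit_zero]

theorem proposition2p1 (ν : ℕ) :
    -- (i) the function is well defined, and equals the transformed series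
    (∀ q : ℂ, ‖q‖ < 1 →
      IsQBessel q ν (qBessel q ν) ∧
      (∀ J : ℂ → ℂ, IsQBessel q ν J → J = qBessel q ν) ∧
      ∀ x : ℂ,
        Multipliable (fun i : ℕ => 1 - (-((1 - q) ^ 2 * x ^ 2)) * (q ^ 2) ^ i) ∧
        Summable (fun k : ℕ => (-1) ^ k * q ^ (2 * k * (k + ν)) * (1 - q) ^ (2 * k) /
          (qPoch (q ^ 2) (q ^ 2) k * qPoch (q ^ 2) (q ^ 2) (k + ν)) * x ^ (2 * k)) ∧
        ((∀ i : ℕ, 1 + (1 - q) ^ 2 * x ^ 2 * q ^ (2 * i) ≠ 0) →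
          qPochInf (-((1 - q) ^ 2 * x ^ 2)) (q ^ 2) ≠ 0 ∧
          qBessel q ν x =
            (1 - q) ^ ν * x ^ ν / qPochInf (-((1 - q) ^ 2 * x ^ 2)) (q ^ 2) *
              ∑' k : ℕ, (-1) ^ k * q ^ (2 * k * (k + ν)) * (1 - q) ^ (2 * k) /
                (qPoch (q ^ 2) (q ^ 2) k * qPoch (q ^ 2) (q ^ 2) (k + ν)) * x ^ (2 * k))) ∧
    -- (ii) leading terms as `q → 0` (every integer division below is exact)
    (∀ n : ℤ,
      (1 ≤ n →
        HasLeadingTerm (fun q => qBessel q ν (q ^ n)) 1 (n * ν) 1) ∧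
      (n ≤ 0 → -(ν : ℤ) ≤ n →
        HasLeadingTerm (fun q => qBessel q ν (q ^ n)) 1 (n * (n + ν - 1)) (1 / 2)) ∧
      (n ≤ -(ν : ℤ) - 1 → Even (n + ν) →
        HasLeadingTerm (fun q => qBessel q ν (q ^ n))
          ((-1) ^ ((n + ν) / 2)) ((n * (n - 2) - (ν : ℤ) ^ 2) / 2) (1 / 2)) ∧
      (n ≤ -(ν : ℤ) - 1 → Odd (n + ν) →
        HasLeadingTerm (fun q => qBessel q ν (q ^ n))
          ((-1) ^ ((n + ν + 1) / 2)) ((n * (n - 2) - (ν : ℤ) ^ 2 + 3) / 2) 1)) := by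
  refine ⟨fun q hq => ⟨isQBessel_qBessel hq ν, fun J hJ => hJ.unique (isQBessel_qBessel hq ν),
    qBessel_eq_transformed hq ν⟩, fun n => ⟨hasLeadingTerm_qBessel_of_pos ν, fun hn hν => ?_,
      fun hn hev => ?_, fun hn hodd => ?_⟩⟩
  · have hd := hasLeadingTerm_qBessel_of_dominant (ν := ν) (r := 0) (e := 0) hn
      (fun k => by have : 0 ≤ (k : ℤ) + ν + n := by lia
                   positivity)
      (fun k => ⟨fun h => ?_, fun h => by simp [h]⟩) rfl
    · simpa using hd
    · by_contra hk
      have h1 : 0 < (k : ℤ) := by lia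
      have h2 : 0 < (k : ℤ) + ν + n := by lia
      have h3 : 0 < 2 * (k : ℤ) * (k + ν + n) := by positivity
      exact h3.ne' h
  · obtain ⟨a, ha⟩ := hev
    obtain ⟨r, rfl⟩ : ∃ r : ℕ, a = -r := ⟨a.natAbs, by lia⟩
    have hsq : ∀ k : ℕ, 2 * (k : ℤ) * (k + ν + n) =
        2 * ((k : ℤ) - r) ^ 2 + -(2 * (r : ℤ) ^ 2) := fun k => by
      rw [add_assoc, add_comm (ν : ℤ) n, ha]; ring
    have hsign : (-1 : ℂ) ^ ((n + ν) / 2) = (-1) ^ r := by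
      rw [ha, ← two_mul, Int.mul_ediv_cancel_left _ two_ne_zero, zpow_neg, zpow_natCast, ← inv_pow,
        inv_neg_one]
    rw [hsign]
    refine hasLeadingTerm_qBessel_of_dominant (e := -(2 * (r : ℤ) ^ 2)) (by lia)
      (fun k => ?_) (fun k => ?_) ?_
    · rw [hsq]
      nlinarith [sq_nonneg ((k : ℤ) - r)]
    · rw [hsq, add_eq_right, mul_eq_zero_iff_left two_ne_zero, sq_eq_zero_iff, sub_eq_zero,
        Nat.cast_inj]
    · obtain rfl : n = -2 * r - ν := by lia
      apply Int.ediv_eq_of_eq_mul_right two_ne_zero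
      ring
  · obtain ⟨a, ha⟩ := hodd
    obtain ⟨r, rfl⟩ : ∃ r : ℕ, a = -r - 1 := ⟨(a + 1).natAbs, by lia⟩
    have hsign : (-1 : ℂ) ^ ((n + ν + 1) / 2) = (-1) ^ r := by
      rw [show (n + ν + 1) = 2 * (-(r : ℤ)) by lia, Int.mul_ediv_cancel_left _ two_ne_zero,
        zpow_neg, zpow_natCast, ← inv_pow, inv_neg_one]
    rw [hsign]
    convert hasLeadingTerm_qBessel_of_odd (ν := ν) (r := r) (n := n) (by lia) (by lia) using 1
    obtain rfl : n = -2 * r - 1 - ν := by lia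
    apply Int.ediv_eq_of_eq_mul_right two_ne_zero
    ring
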